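/- Let $K$ be an arbitrary field, $l\ge 1$, and let $\Phi$ be the root system $A_l$, realized as $\{\varepsilon_i-\varepsilon_j : 0\le i\ne j\le l\}$, with simple roots $\varepsilon_{k}-\varepsilon_{k+1}$ ($0\le k<l$) and maximal root $\delta=\varepsilon_0-\varepsilon_l$. Let $V=\mathfrak{sl}_{l+1}(K)$ be the corresponding Lie algebra, with root vectors $e_\alpha=E_{ij}$ for $\alpha=\varepsilon_i-\varepsilon_j$, and let the simply connected group $G=\mathrm{SL}(l+1,K)$, with root elements $x_\alpha(a)=1+aE_{ij}$, act on $V$ by conjugation. Put $\Phi_0=\{\alpha\in\Phi:\alpha\perp\delta\}$ and $\Phi_1=\{\alpha\in\Phi:\angle(\alpha,\delta)=\pi/3\}$, let $V_1=\langle e_\alpha:\alpha\in\Phi_1\rangle$, and let $G_0=G_{\mathrm{sc}}(\Phi_0,K)$ be the subgroup of $G$ generated by all $x_\alpha(a)$ with $\alpha\in\Phi_0$, $a\in K$; it acts on $V_1$. Write $\rho=\varepsilon_0-\varepsilon_1$ for the first and $\sigma=\varepsilon_{l-1}-\varepsilon_l$ for the last simple root, so that $\delta-\rho=\varepsilon_1-\varepsilon_l$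 for $l\ge 2$. Then the orbits of $G_0$ on $V_1$ are as follows. 1. If $l=1$, then $V_1=\{0\}$, and there is only the zero orbit. 2. If $l=2$, then every vector of $V_1$ is uniquely of the form $a e_\rho+b e_{\delta-\rho}$ with $a,b\in K$, and every vector of $V_1$ forms an orbit by itself. 3. If $l=3$, then every vector of $V_1$ lies in the orbit of one of the vectors $$0;\qquad e_\rho;\qquad e_\sigma;\qquad e_\rho+c\,e_\sigma\ (c\in K^*);\qquad e_\rho+c\,e_{\delta-\rho}\ (c\in K^*),$$ and the listed vectors (different types, or the same type with different values of $c$) lie in pairwise different orbits. 4. If $l>3$, then every vector of $V_1$ lies in the orbit of one of the vectors $$0;\qquad e_\rho;\qquad e_\sigma;\qquad e_\rho+e_\sigma;\qquad e_\rho+c\,e_{\delta-\rho}\ (c\in K^*),$$ and the listed vectors (different types, or the same type with different values of $c$) lie in pairwise different orbits. -/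

import Mathlib

namespace TypeA

open Matrix

attribute [local instance] LieRing.ofAssociativeRing

/-- The roots of `A_l`: the pair `(i, j)` with `i ≠ j`, where `i, j ∈ {0, …, l}`, stands for the
root `ε_i - ε_j`. -/
abbrev Root (l : ℕ) : Type := {p : Fin (l + 1) × Fin (l + 1) // p.1 ≠ p.2}

/-- The root `ε_i - ε_j` as a vector in the lattice `ℤ^{l+1}`. -/
def Root.vec {l : ℕ} (α : Root l) : Fin (l + 1) → ℤ :=
  Pi.single α.1.1 1 - Pi.single α.1.2 1

/-- The simple root `α_{k+1} = ε_k - ε_{k+1}`, for `k = 0, …, l - 1`. -/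
def simpleRoot {l : ℕ} (k : Fin l) : Root l :=
  ⟨(k.castSucc, k.succ), k.castSucc_lt_succ.ne⟩

/-- The maximal root `δ = ε_0 - ε_l`. -/
def delta (l : ℕ) [NeZero l] : Root l :=
  ⟨(0, Fin.last l), Fin.last_pos'.ne⟩

/-- `Φ_i`: the roots whose scalar product with `δ` is `i`. All roots have square length `2`, so
`Φ_1` consists of the roots at angle `π/3` to `δ`, and `Φ_0` of the roots orthogonal to `δ`. -/
def Phi (l : ℕ) [NeZero l] (i : ℤ) : Set (Root l) :=
  {α | α.vec ⬝ᵥ (delta l).vec = i}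

/-- `ρ = 10…00`, the first simple root. -/
def rho (l : ℕ) [NeZero l] : Root l :=
  simpleRoot ⟨0, Nat.pos_of_neZero l⟩

/-- `σ = 00…01`, the last simple root. -/
def sigma (l : ℕ) [NeZero l] : Root l :=
  simpleRoot ⟨l - 1, Nat.sub_one_lt (NeZero.ne l)⟩

/-- The root `δ - ρ = ε_1 - ε_l`; see `vec_deltaSubRho`. -/
def deltaSubRho (l : ℕ) [NeZero l] (hl : 2 ≤ l) : Root l :=
  ⟨(⟨1, by omega⟩, Fin.last l), by
    intro h
    have := congrArg Fin.val h
    simp at this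
    omega⟩

theorem vec_deltaSubRho (l : ℕ) [NeZero l] (hl : 2 ≤ l) :
    (deltaSubRho l hl).vec = (delta l).vec - (rho l).vec := by
  simp only [Root.vec, deltaSubRho, delta, rho, simpleRoot]
  have h0 : (Fin.castSucc ⟨0, Nat.pos_of_neZero l⟩ : Fin (l + 1)) = 0 := rfl
  have h1 : (Fin.succ ⟨0, Nat.pos_of_neZero l⟩ : Fin (l + 1)) = ⟨1, by omega⟩ := rfl
  rw [h0, h1]
  abel

/-- The Lie algebra `V = V(A_l) = sl_{l+1}(K)`. -/
abbrev V (l : ℕ) (K : Type*) [Field K] : LieSubalgebra K (Matrix (Fin (l + 1)) (Fin (l + 1)) K) :=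
  LieAlgebra.SpecialLinear.sl (Fin (l + 1)) K

/-- The simply connected group `G = G_sc(A_l, K) = SL(l+1, K)`. -/
abbrev G (l : ℕ) (K : Type*) [Field K] : Type _ :=
  SpecialLinearGroup (Fin (l + 1)) K

/-- The elementary root element `e_α ∈ V` of the (positive) Chevalley basis of matrix units:
`e_α = E_{ij}` for `α = ε_i - ε_j`. -/
def e {l : ℕ} (K : Type*) [Field K] (α : Root l) : V l K :=
  LieAlgebra.SpecialLinear.single α.1.1 α.1.2 α.2 1

/-- The elementary root element `x_α(a) = 1 + a E_{ij} ∈ G` for `α = ε_i - ε_j`. -/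
def x {l : ℕ} {K : Type*} [Field K] (α : Root l) (a : K) : G l K :=
  SpecialLinearGroup.transvection α.2 a

/-- The (adjoint) action of `G` on `V` by conjugation of matrices. -/
instance actionV (l : ℕ) (K : Type*) [Field K] : MulAction (G l K) (V l K) where
  smul g v := ⟨g.1 * v.1 * g⁻¹.1, by
    have hv : Matrix.trace v.1 = 0 := v.2
    change Matrix.trace (g.1 * v.1 * g⁻¹.1) = 0
    rw [Matrix.trace_mul_comm, ← mul_assoc]
    change Matrix.trace ((g⁻¹ * g).1 * v.1) = 0
    rw [inv_mul_cancel]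
    change Matrix.trace (1 * v.1) = 0
    rw [one_mul, hv]⟩
  one_smul v := by
    apply Subtype.ext
    change (1 : G l K).1 * v.1 * (1 : G l K)⁻¹.1 = v.1
    rw [inv_one]
    change 1 * v.1 * 1 = v.1
    rw [one_mul, mul_one]
  mul_smul g h v := by
    apply Subtype.ext
    change (g * h).1 * v.1 * (g * h)⁻¹.1 = g.1 * (h.1 * v.1 * h⁻¹.1) * g⁻¹.1
    rw [_root_.mul_inv_rev]
    change (g.1 * h.1) * v.1 * (h⁻¹.1 * g⁻¹.1) = _
    simp only [mul_assoc]

theorem coe_smul {l : ℕ} {K : Type*} [Field K] (g : G l K) (v : V l K) :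
    (g • v).1 = g.1 * v.1 * g⁻¹.1 :=
  rfl

/-- `V_1`: the span of the `e_α` with `α ∈ Φ_1`. -/
def V1 (l : ℕ) [NeZero l] (K : Type*) [Field K] : Submodule K (V l K) :=
  Submodule.span K (e K '' Phi l 1)

/-- `G_0 = G_sc(Φ_0, K)`, as the subgroup of `G` generated by the elementary root subgroups
`X_α = ⟨x_α(a) ; a ∈ K⟩` with `α ∈ Φ_0`. In matrices this is the group of all
`diag(1, g', 1)` with `g' ∈ SL(l-1, K)`. -/
def G0 (l : ℕ) [NeZero l] (K : Type*) [Field K] : Subgroup (G l K) :=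
  Subgroup.closure {g | ∃ α ∈ Phi l 0, ∃ a : K, g = x α a}

theorem mem_Phi_iff {l : ℕ} [NeZero l] (i : ℤ) (α : Root l) : α ∈ Phi l i ↔
    ((if α.1.1 = 0 then 1 else 0) - (if α.1.2 = 0 then 1 else 0)) -
      ((if α.1.1 = Fin.last l then 1 else 0) - (if α.1.2 = Fin.last l then 1 else 0)) = i := by
  simp only [Phi, Set.mem_ofPred_eq, Root.vec, delta, dotProduct_sub, dotProduct_single, mul_one,
    Pi.sub_apply, Pi.single_apply, eq_comm]

theorem mem_Phi_zero_iff {l : ℕ} [NeZero l] (α : Root l) : α ∈ Phi l 0 ↔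
    (α.1.1 ≠ 0 ∧ α.1.1 ≠ Fin.last l) ∧ (α.1.2 ≠ 0 ∧ α.1.2 ≠ Fin.last l) := by
  rw [mem_Phi_iff]
  have h := α.2
  have hl : (0 : Fin (l + 1)) ≠ Fin.last l := (delta l).2
  grind

theorem mem_Phi_one_iff {l : ℕ} [NeZero l] (α : Root l) : α ∈ Phi l 1 ↔
    (α.1.1 = 0 ∧ α.1.2 ≠ Fin.last l) ∨ (α.1.1 ≠ 0 ∧ α.1.2 = Fin.last l) := by
  rw [mem_Phi_iff]
  have h := α.2
  have hl : (0 : Fin (l + 1)) ≠ Fin.last l := (delta l).2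
  grind

theorem x_smul_e_mem_V1 {l : ℕ} [NeZero l] {K : Type*} [Field K] {α β : Root l}
    (hα : α ∈ Phi l 0) (hβ : β ∈ Phi l 1) (a : K) : x α a • e K β ∈ V1 l K := by
  obtain ⟨⟨i, j⟩, hij⟩ := α
  obtain ⟨⟨p, q⟩, hpq⟩ := β
  have hβ' := hβ
  rw [mem_Phi_zero_iff] at hα
  rw [mem_Phi_one_iff] at hβ
  dsimp only at hα hβ hij hpq
  obtain ⟨⟨hi0, hil⟩, hj0, hjl⟩ := hα
  have hmem : ∀ γ ∈ Phi l 1, e K γ ∈ V1 l K := fun γ hγ => Submodule.subset_span ⟨γ, hγ, rfl⟩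
  have hx : (x (⟨(i, j), hij⟩ : Root l) a).1 = 1 + Matrix.single i j a := rfl
  have hx' : (x (⟨(i, j), hij⟩ : Root l) a)⁻¹.1 = 1 + Matrix.single i j (-a) := by
    rw [x, SpecialLinearGroup.transvection_inv]
    rfl
  have he : (e K (⟨(p, q), hpq⟩ : Root l)).1 = Matrix.single p q 1 := rfl
  rcases hβ with ⟨hp, hq⟩ | ⟨hp, hq⟩
  · subst hp
    by_cases hqi : q = i
    · subst hqi
      have : x (⟨(q, j), hij⟩ : Root l) a • e K (⟨(0, q), hpq⟩ : Root l) =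
          e K ⟨(0, q), hpq⟩ + (-a) • e K ⟨(0, j), hj0.symm⟩ := by
        apply Subtype.ext
        rw [coe_smul, hx, hx', he]
        change _ = Matrix.single 0 q 1 + (-a) • Matrix.single 0 j 1
        simp [add_mul, mul_add, hj0, Matrix.smul_single, Matrix.single_neg]
      rw [this]
      exact add_mem (hmem _ hβ') (Submodule.smul_mem _ _ (hmem _ (by
        rw [mem_Phi_one_iff]; exact Or.inl ⟨rfl, hjl⟩)))
    · have : x (⟨(i, j), hij⟩ : Root l) a • e K (⟨(0, q), hpq⟩ : Root l) =
          e K ⟨(0, q), hpq⟩ := by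
        apply Subtype.ext
        rw [coe_smul, hx, hx', he]
        simp [add_mul, mul_add, hj0, hqi]
      rw [this]
      exact hmem _ hβ'
  · subst hq
    by_cases hpj : p = j
    · subst hpj
      have : x (⟨(i, p), hij⟩ : Root l) a • e K (⟨(p, Fin.last l), hpq⟩ : Root l) =
          e K ⟨(p, Fin.last l), hpq⟩ + a • e K ⟨(i, Fin.last l), hil⟩ := by
        apply Subtype.ext
        rw [coe_smul, hx, hx', he]
        change _ = Matrix.single p (Fin.last l) 1 + a • Matrix.single i (Fin.last l) 1
        simp [add_mul, mul_add, Ne.symm hil, Matrix.smul_single]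
      rw [this]
      exact add_mem (hmem _ hβ') (Submodule.smul_mem _ _ (hmem _ (by
        rw [mem_Phi_one_iff]; exact Or.inr ⟨hi0, rfl⟩)))
    · have : x (⟨(i, j), hij⟩ : Root l) a • e K (⟨(p, Fin.last l), hpq⟩ : Root l) =
          e K ⟨(p, Fin.last l), hpq⟩ := by
        apply Subtype.ext
        rw [coe_smul, hx, hx', he]
        simp [add_mul, mul_add, Ne.symm hil, Ne.symm hpj]
      rw [this]
      exact hmem _ hβ'

theorem smul_mem_V1 {l : ℕ} [NeZero l] {K : Type*} [Field K] {g : G l K} (hg : g ∈ G0 l K)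
    {v : V l K} (hv : v ∈ V1 l K) : g • v ∈ V1 l K := by
  have key : ∀ α ∈ Phi l 0, ∀ (a : K) (w : V l K), w ∈ V1 l K → x α a • w ∈ V1 l K := by
    intro α hα a w hw
    induction hw using Submodule.span_induction with
    | mem w hw =>
      obtain ⟨β, hβ, rfl⟩ := hw
      exact x_smul_e_mem_V1 hα hβ a
    | zero =>
      have : x α a • (0 : V l K) = 0 := Subtype.ext (by rw [coe_smul]; simp)
      rw [this]
      exact zero_mem _
    | add u w _ _ hu hw =>
      have : x α a • (u + w) = x α a • u + x α a • w := Subtype.ext (by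
        change (x α a).1 * (u.1 + w.1) * (x α a)⁻¹.1 =
          (x α a).1 * u.1 * (x α a)⁻¹.1 + (x α a).1 * w.1 * (x α a)⁻¹.1
        rw [mul_add, add_mul])
      rw [this]
      exact add_mem hu hw
    | smul c w _ hw =>
      have : x α a • (c • w) = c • (x α a • w) := Subtype.ext (by
        change (x α a).1 * (c • w.1) * (x α a)⁻¹.1 = c • ((x α a).1 * w.1 * (x α a)⁻¹.1)
        rw [mul_smul_comm, smul_mul_assoc])
      rw [this]
      exact Submodule.smul_mem _ _ hw
  induction hg using Subgroup.closure_induction'' generalizing v with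
  | one => rwa [one_smul]
  | mul g h _ _ ihg ihh => rw [mul_smul]; exact ihg (ihh hv)
  | mem g hg =>
    obtain ⟨α, hα, a, rfl⟩ := hg
    exact key α hα a v hv
  | inv_mem g hg =>
    obtain ⟨α, hα, a, rfl⟩ := hg
    rw [x, SpecialLinearGroup.transvection_inv]
    exact key α hα (-a) v hv

/-- The action of `G_0` on `V_1`. -/
instance actionV1 (l : ℕ) [NeZero l] (K : Type*) [Field K] : MulAction (G0 l K) (V1 l K) where
  smul g v := ⟨(g : G l K) • (v : V l K), smul_mem_V1 g.2 v.2⟩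
  one_smul v := Subtype.ext (one_smul (G l K) (v : V l K))
  mul_smul g h v := Subtype.ext (mul_smul (g : G l K) (h : G l K) (v : V l K))

/-- The root element `e_α` as a vector of `V_1`, for `α ∈ Φ_1`. -/
def e1 {l : ℕ} [NeZero l] (K : Type*) [Field K] (α : Root l) (hα : α ∈ Phi l 1) : V1 l K :=
  ⟨e K α, Submodule.subset_span ⟨α, hα, rfl⟩⟩

theorem rho_mem {l : ℕ} [NeZero l] (hl : 2 ≤ l) : rho l ∈ Phi l 1 := by
  rw [mem_Phi_one_iff]
  refine Or.inl ⟨rfl, fun h => ?_⟩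
  have : (1 : ℕ) = l := congrArg Fin.val h
  omega

theorem sigma_mem {l : ℕ} [NeZero l] (hl : 2 ≤ l) : sigma l ∈ Phi l 1 := by
  rw [mem_Phi_one_iff]
  refine Or.inr ⟨fun h => ?_, Fin.ext ?_⟩
  · have := congrArg Fin.val h
    simp [sigma, simpleRoot] at this
    omega
  · simp [sigma, simpleRoot]
    omega

theorem deltaSubRho_mem {l : ℕ} [NeZero l] (hl : 2 ≤ l) : deltaSubRho l hl ∈ Phi l 1 := by
  rw [mem_Phi_one_iff]
  refine Or.inr ⟨fun h => ?_, rfl⟩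
  have := congrArg Fin.val h
  simp [deltaSubRho] at this

/-- The vector `e_ρ ∈ V_1`, for `l ≥ 2`. -/
def eRho (l : ℕ) [NeZero l] (K : Type*) [Field K] (hl : 2 ≤ l) : V1 l K :=
  e1 K (rho l) (rho_mem hl)

/-- The vector `e_σ ∈ V_1`, for `l ≥ 2`. -/
def eSigma (l : ℕ) [NeZero l] (K : Type*) [Field K] (hl : 2 ≤ l) : V1 l K :=
  e1 K (sigma l) (sigma_mem hl)

/-- The vector `e_{δ-ρ} ∈ V_1`, for `l ≥ 2`. -/
def eDeltaSubRho (l : ℕ) [NeZero l] (K : Type*) [Field K] (hl : 2 ≤ l) : V1 l K :=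
  e1 K (deltaSubRho l hl) (deltaSubRho_mem hl)

/-- The labels of the types of vectors for `l = 3`; nonzero parameters run over `K^*`. -/
inductive Types3 (K : Type*) [Field K] : Type _
  | I
  | IIa
  | IIb
  | III (c : Kˣ)
  | VI (c : Kˣ)

/-- The labels of the types of vectors for `l > 3`; nonzero parameters run over `K^*`. -/
inductive TypesGT3 (K : Type*) [Field K] : Type _
  | I
  | IIa
  | IIb
  | III
  | VI (c : Kˣ)

/-- The vector of a given type, for `l = 3`. -/
def Types3.vector {K : Type*} [Field K] (l : ℕ) [NeZero l] (hl : l = 3) : Types3 K → V1 l K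
  | .I => 0
  | .IIa => eRho l K (by omega)
  | .IIb => eSigma l K (by omega)
  | .III c => eRho l K (by omega) + (c : K) • eSigma l K (by omega)
  | .VI c => eRho l K (by omega) + (c : K) • eDeltaSubRho l K (by omega)

/-- The vector of a given type, for `l > 3`. -/
def TypesGT3.vector {K : Type*} [Field K] (l : ℕ) [NeZero l] (hl : 3 < l) : TypesGT3 K → V1 l K
  | .I => 0
  | .IIa => eRho l K (by omega)
  | .IIb => eSigma l K (by omega)
  | .III => eRho l K (by omega) + eSigma l K (by omega)
  | .VI c => eRho l K (by omega) + (c : K) • eDeltaSubRho l K (by omega)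

end TypeA

namespace TypeA

open Matrix

/-! ### Outer products and orbits. -/

section Auxiliary

/-! For `l = n + 2`, a vector of `V_1` is a row `r` in the positions `(0, j)` plus a column `c` in
the positions `(i, l)`, with `0 < i, j < l`. An element `diag(1, g, 1)` of `G_0` acts by `r ↦ r
g⁻¹`, `c ↦ g c`; on generators this is `x0_smul_ofCoords`. Hence the vanishing of `r`, the vanishing
of `c` and the product `r ⬝ᵥ c` are constant on orbits (`orbit_invariants`).

Conversely, let `l ≥ 3`. Transvections carry a nonzero `r`, or a nonzero `c` when `r = 0`, to a
basis vector (`elimination`). Once `r` is the basis vector at `0`, the transvections with `i ≠ 0`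
fix it and still add multiples of any entry of `c` to `c i`. If `c 0 ≠ 0`, this entry clears all
others, and its value is `r ⬝ᵥ c` (`elimination_of_pivot`). If `c 0 = 0` and `c ≠ 0`, then for `l >
3` at least two indices remain and `c` becomes a basis vector (`coords_induction_orthogonal`). For
`l = 3` only one index remains and its coefficient `d` survives, because `SL_2` preserves the
relation `c = d (-r 1, r 0)`.

For `l = 2` there are no roots orthogonal to `δ`, so `G_0` is trivial; for `l = 1` the set `Φ_1` is
empty. -/

theorem vecMulVec_sum {m n R ι : Type*} [NonUnitalNonAssocSemiring R] (u : m → R)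
    (s : Finset ι) (w : ι → n → R) :
    vecMulVec u (∑ i ∈ s, w i) = ∑ i ∈ s, vecMulVec u (w i) := by
  ext p q
  simp [vecMulVec_apply, Matrix.sum_apply, Finset.mul_sum]

theorem sum_vecMulVec {m n R ι : Type*} [NonUnitalNonAssocSemiring R] (s : Finset ι)
    (u : ι → m → R) (w : n → R) :
    vecMulVec (∑ i ∈ s, u i) w = ∑ i ∈ s, vecMulVec (u i) w := by
  ext p q
  simp [vecMulVec_apply, Matrix.sum_apply, Finset.sum_mul]

theorem mem_orbit_of_smul_mem {G X : Type*} [Group G] [MulAction G X] {g : G} {v w : X}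
    (h : g • v ∈ MulAction.orbit G w) : v ∈ MulAction.orbit G w := by
  rw [← MulAction.orbit_eq_iff] at h ⊢
  rw [← h, MulAction.orbit_smul]

end Auxiliary

/-! ### Row and column coordinates on `V_1`. -/

section Coordinates

variable {n : ℕ} {K : Type*} [Field K]

/-- The indices `1, …, l - 1` of `{0, …, l}`, for `l = n + 2`. -/
def mid (i : Fin (n + 1)) : Fin (n + 2 + 1) := i.castSucc.succ

theorem mid_injective : Function.Injective (mid (n := n)) :=
  (Fin.succ_injective _).comp (Fin.castSucc_injective _)

theorem mid_ne_zero (i : Fin (n + 1)) : mid i ≠ 0 := Fin.succ_ne_zero _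

theorem mid_ne_last (i : Fin (n + 1)) : mid i ≠ Fin.last (n + 2) := by
  intro h
  have := congrArg Fin.val h
  simp [mid] at this
  omega

theorem exists_mid_eq {p : Fin (n + 2 + 1)} (h0 : p ≠ 0) (hl : p ≠ Fin.last (n + 2)) :
    ∃ i, mid i = p := by
  obtain ⟨q, rfl⟩ := Fin.exists_succ_eq.2 h0
  have hq : q ≠ Fin.last (n + 1) := by
    rintro rfl
    exact hl (Fin.succ_last _)
  obtain ⟨i, rfl⟩ := Fin.exists_castSucc_eq.2 hq
  exact ⟨i, rfl⟩

/-- The root `ε_0 - ε_j`, for `0 < j < l`. -/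
def rowRoot (j : Fin (n + 1)) : Root (n + 2) := ⟨(0, mid j), (mid_ne_zero j).symm⟩

/-- The root `ε_i - ε_l`, for `0 < i < l`. -/
def colRoot (i : Fin (n + 1)) : Root (n + 2) := ⟨(mid i, Fin.last _), mid_ne_last i⟩

/-- The root `ε_i - ε_j`, for `0 < i, j < l`. -/
def midRoot (i j : Fin (n + 1)) (h : i ≠ j) : Root (n + 2) :=
  ⟨(mid i, mid j), mid_injective.ne h⟩

theorem rowRoot_mem [NeZero (n + 2)] (j : Fin (n + 1)) : rowRoot j ∈ Phi (n + 2) 1 :=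
  (mem_Phi_one_iff _).2 (Or.inl ⟨rfl, mid_ne_last j⟩)

theorem colRoot_mem [NeZero (n + 2)] (i : Fin (n + 1)) : colRoot i ∈ Phi (n + 2) 1 :=
  (mem_Phi_one_iff _).2 (Or.inr ⟨mid_ne_zero i, rfl⟩)

theorem midRoot_mem [NeZero (n + 2)] {i j : Fin (n + 1)} (h : i ≠ j) :
    midRoot i j h ∈ Phi (n + 2) 0 :=
  (mem_Phi_zero_iff _).2 ⟨⟨mid_ne_zero i, mid_ne_last i⟩, mid_ne_zero j, mid_ne_last j⟩

theorem exists_eq_midRoot [NeZero (n + 2)] {α : Root (n + 2)} (hα : α ∈ Phi (n + 2) 0) :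
    ∃ (i j : Fin (n + 1)) (h : i ≠ j), α = midRoot i j h := by
  obtain ⟨⟨p, q⟩, hpq⟩ := α
  obtain ⟨⟨hp0, hpl⟩, hq0, hql⟩ := (mem_Phi_zero_iff _).1 hα
  obtain ⟨i, rfl⟩ := exists_mid_eq hp0 hpl
  obtain ⟨j, rfl⟩ := exists_mid_eq hq0 hql
  exact ⟨i, j, fun h => hpq (congrArg mid h), rfl⟩

/-- The vector of `V_1` with given coefficients at the `ε_0 - ε_j` and at the `ε_i - ε_l`. -/
def ofCoords (n : ℕ) [NeZero (n + 2)] (K : Type*) [Field K] :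
    ((Fin (n + 1) → K) × (Fin (n + 1) → K)) →ₗ[K] V1 (n + 2) K :=
  (Fintype.linearCombination K fun j => e1 K (rowRoot j) (rowRoot_mem j)).coprod
    (Fintype.linearCombination K fun i => e1 K (colRoot i) (colRoot_mem i))

/-- Extension by zero of a vector with indices `1, …, l - 1`. -/
def extend (n : ℕ) (K : Type*) [Field K] : (Fin (n + 1) → K) →ₗ[K] (Fin (n + 2 + 1) → K) :=
  Fintype.linearCombination K fun i => Pi.single (mid i) 1

theorem extend_single (i : Fin (n + 1)) (a : K) :
    extend n K (Pi.single i a) = Pi.single (mid i) a := by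
  simp [extend, Fintype.linearCombination_apply_single, ← Pi.single_smul]

theorem extend_mid (c : Fin (n + 1) → K) (i : Fin (n + 1)) : extend n K c (mid i) = c i := by
  simp [extend, Fintype.linearCombination_apply, Finset.sum_apply, Pi.single_apply,
    mid_injective.eq_iff]

/-- As a sum of two outer products, the matrix is conjugated factor by factor: left multiplication
acts on the first factors, right multiplication on the second. -/
theorem coe_ofCoords [NeZero (n + 2)] (r c : Fin (n + 1) → K) :
    (ofCoords n K (r, c)).1.1 = vecMulVec (Pi.single 0 1) (extend n K r) +
      vecMulVec (extend n K c) (Pi.single (Fin.last _) 1) := by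
  have h1 : ∀ r : Fin (n + 1) → K, (ofCoords n K (r, 0)).1.1 =
      vecMulVec (Pi.single 0 1) (extend n K r) := by
    intro r
    simp only [ofCoords, extend, LinearMap.coprod_apply, map_zero, add_zero,
      Fintype.linearCombination_apply, AddSubmonoidClass.coe_finsetSum]
    rw [vecMulVec_sum]
    refine Finset.sum_congr rfl fun j _ => ?_
    rw [vecMulVec_smul]
    change r j • Matrix.single 0 (mid j) 1 = _
    rw [Matrix.single_eq_single_vecMulVec_single]
  have h2 : ∀ c : Fin (n + 1) → K, (ofCoords n K (0, c)).1.1 =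
      vecMulVec (extend n K c) (Pi.single (Fin.last _) 1) := by
    intro c
    simp only [ofCoords, extend, LinearMap.coprod_apply, map_zero, zero_add,
      Fintype.linearCombination_apply, AddSubmonoidClass.coe_finsetSum]
    rw [sum_vecMulVec]
    refine Finset.sum_congr rfl fun j _ => ?_
    rw [smul_vecMulVec]
    change c j • Matrix.single (mid j) (Fin.last _) 1 = _
    rw [Matrix.single_eq_single_vecMulVec_single]
  rw [← h1, ← h2, show (r, c) = (r, 0) + (0, c) by simp, map_add]
  rfl

theorem ofCoords_injective [NeZero (n + 2)] : Function.Injective (ofCoords n K) := by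
  rw [injective_iff_map_eq_zero]
  rintro ⟨r, c⟩ h
  have h' : (ofCoords n K (r, c)).1.1 = 0 := by rw [h]; rfl
  rw [coe_ofCoords] at h'
  have hr : r = 0 := by
    ext j
    have := congrFun (congrFun h' 0) (mid j)
    simpa [vecMulVec_apply, extend_mid, mid_ne_last] using this
  have hc : c = 0 := by
    ext i
    have := congrFun (congrFun h' (mid i)) (Fin.last _)
    simpa [vecMulVec_apply, extend_mid, mid_ne_zero] using this
  rw [hr, hc, Prod.mk_zero_zero]

theorem ofCoords_single_left [NeZero (n + 2)] (j : Fin (n + 1)) :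
    ofCoords n K (Pi.single j 1, 0) = e1 K (rowRoot j) (rowRoot_mem j) := by
  simp [ofCoords, Fintype.linearCombination_apply_single]

theorem ofCoords_single_right [NeZero (n + 2)] (i : Fin (n + 1)) :
    ofCoords n K (0, Pi.single i 1) = e1 K (colRoot i) (colRoot_mem i) := by
  simp [ofCoords, Fintype.linearCombination_apply_single]

theorem ofCoords_surjective [NeZero (n + 2)] : Function.Surjective (ofCoords n K) := by
  rintro ⟨v, hv⟩
  suffices h : V1 (n + 2) K ≤ (LinearMap.range (ofCoords n K)).map (V1 (n + 2) K).subtype by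
    obtain ⟨w, ⟨p, rfl⟩, hw⟩ := h hv
    exact ⟨p, Subtype.ext hw⟩
  refine Submodule.span_le.2 ?_
  rintro _ ⟨⟨⟨p, q⟩, hpq⟩, hα, rfl⟩
  rcases (mem_Phi_one_iff _).1 hα with ⟨hp, hq⟩ | ⟨hp, hq⟩ <;> dsimp only at hp hq hpq
  · subst hp
    obtain ⟨j, rfl⟩ := exists_mid_eq hpq.symm hq
    exact ⟨_, ⟨_, ofCoords_single_left j⟩, rfl⟩
  · subst hq
    obtain ⟨i, rfl⟩ := exists_mid_eq hp hpq
    exact ⟨_, ⟨_, ofCoords_single_right i⟩, rfl⟩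

/-- The root element of `G_0` belonging to `ε_i - ε_j`. -/
def x0 [NeZero (n + 2)] {i j : Fin (n + 1)} (h : i ≠ j) (a : K) : G0 (n + 2) K :=
  ⟨x (midRoot i j h) a, Subgroup.subset_closure ⟨_, midRoot_mem h, a, rfl⟩⟩

theorem x0_smul_ofCoords [NeZero (n + 2)] {i j : Fin (n + 1)} (h : i ≠ j) (a : K)
    (r c : Fin (n + 1) → K) : x0 h a • ofCoords n K (r, c) =
      ofCoords n K (r + Pi.single j (-a * r i), c + Pi.single i (a * c j)) := by
  apply Subtype.ext
  apply Subtype.ext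
  change (x (midRoot i j h) a • (ofCoords n K (r, c)).1).1 = _
  have hx : (x (midRoot i j h) a).1 = 1 + Matrix.single (mid i) (mid j) a := rfl
  have hx' : (x (midRoot i j h) a)⁻¹.1 = 1 + Matrix.single (mid i) (mid j) (-a) := by
    rw [x, SpecialLinearGroup.transvection_inv]
    rfl
  -- The explicit arguments distribute only over the sum of the two outer products and keep the
  -- factors `1 + single` intact.
  rw [coe_smul, hx, hx', coe_ofCoords, coe_ofCoords, mul_add (1 + _) (vecMulVec _ _),
    add_mul (_ * vecMulVec _ _), mul_vecMulVec, mul_vecMulVec, vecMulVec_mul, vecMulVec_mul]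
  simp only [add_mulVec, vecMul_add, one_mulVec, vecMul_one, map_add, extend_single]
  -- One goal per factor: the basis vectors at `0` and at `l` are fixed, since `i` and `j` lie
  -- strictly between; the row and the column change.
  congr 2
  · ext p
    simp [mid_ne_zero, Pi.single_apply]
  · congr 1
    ext p
    by_cases hp : p = mid j <;>
      simp [Matrix.vecMul, dotProduct, Matrix.single_apply, extend_mid, eq_comm, hp, mul_comm a]
  · congr 1
    ext p
    by_cases hp : p = mid i <;>
      simp [Matrix.mulVec, dotProduct, Matrix.single_apply, extend_mid, eq_comm, hp]
  · ext p
    simp [Pi.single_apply, mid_ne_last]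

end Coordinates

/-! ### Invariants of the orbits. -/

section Invariants

variable {n : ℕ} [NeZero (n + 2)] {K : Type*} [Field K]

/-- Generators suffice, and inverses cost nothing since `x α a` has inverse `x α (-a)`. -/
theorem invariant_smul {P : V1 (n + 2) K → Prop}
    (hP : ∀ (i j : Fin (n + 1)) (h : i ≠ j) (a : K) (v), P v → P (x0 h a • v))
    (g : G0 (n + 2) K) {v : V1 (n + 2) K} (hv : P v) : P (g • v) := by
  have gen : ∀ α ∈ Phi (n + 2) 0, ∀ (a : K) (h : x α a ∈ G0 (n + 2) K) (v : V1 (n + 2) K),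
      P v → P ((⟨x α a, h⟩ : G0 (n + 2) K) • v) := by
    intro α hα a h v hv
    obtain ⟨i, j, hij, rfl⟩ := exists_eq_midRoot hα
    exact hP i j hij a v hv
  obtain ⟨g, hg⟩ := g
  induction hg using Subgroup.closure_induction'' generalizing v with
  | one =>
    change P ((1 : G0 (n + 2) K) • v)
    rwa [one_smul]
  | mul g h hg hh ihg ihh =>
    change P (((⟨g, hg⟩ : G0 (n + 2) K) * ⟨h, hh⟩) • v)
    rw [mul_smul]
    exact ihg (ihh hv)
  | mem g hg =>
    obtain ⟨α, hα, a, rfl⟩ := hg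
    exact gen α hα a _ v hv
  | inv_mem g hg =>
    obtain ⟨α, hα, a, rfl⟩ := hg
    have hinv : (x α a)⁻¹ = x α (-a) := SpecialLinearGroup.transvection_inv _ _
    simp only [hinv]
    exact gen α hα (-a) _ v hv

theorem invariant_of_orbit_eq {P : (Fin (n + 1) → K) → (Fin (n + 1) → K) → Prop}
    (hP : ∀ (i j : Fin (n + 1)), i ≠ j → ∀ (a : K) (r c), P r c →
      P (r + Pi.single j (-a * r i)) (c + Pi.single i (a * c j)))
    {r c r' c' : Fin (n + 1) → K}
    (h : MulAction.orbit (G0 (n + 2) K) (ofCoords n K (r, c)) =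
      MulAction.orbit (G0 (n + 2) K) (ofCoords n K (r', c'))) (hrc : P r c) : P r' c' := by
  obtain ⟨g, hg⟩ := MulAction.orbit_eq_iff.1 h.symm
  have := invariant_smul (P := fun v => ∃ r c, P r c ∧ v = ofCoords n K (r, c)) (by
    rintro i j h a _ ⟨r, c, hrc, rfl⟩
    exact ⟨_, _, hP i j h a r c hrc, x0_smul_ofCoords h a r c⟩) g ⟨r, c, hrc, rfl⟩
  obtain ⟨r₁, c₁, h₁, h₂⟩ := this
  obtain ⟨rfl, rfl⟩ := Prod.mk.inj (ofCoords_injective (hg.symm.trans h₂))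
  exact h₁

theorem orbit_invariants {r c r' c' : Fin (n + 1) → K}
    (h : MulAction.orbit (G0 (n + 2) K) (ofCoords n K (r, c)) =
      MulAction.orbit (G0 (n + 2) K) (ofCoords n K (r', c'))) :
    (r = 0 ↔ r' = 0) ∧ (c = 0 ↔ c' = 0) ∧ r ⬝ᵥ c = r' ⬝ᵥ c' := by
  have hr : ∀ (i j : Fin (n + 1)), i ≠ j → ∀ (a : K) (r _c : Fin (n + 1) → K), r = 0 →
      r + Pi.single j (-a * r i) = 0 := by
    rintro i j - a r c rfl
    simp
  have hc : ∀ (i j : Fin (n + 1)), i ≠ j → ∀ (a : K) (_r c : Fin (n + 1) → K), c = 0 →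
      c + Pi.single i (a * c j) = 0 := by
    rintro i j - a r c rfl
    simp
  have hd : ∀ (i j : Fin (n + 1)), i ≠ j → ∀ (a : K) (r₁ c₁ : Fin (n + 1) → K),
      r ⬝ᵥ c = r₁ ⬝ᵥ c₁ →
      r ⬝ᵥ c = (r₁ + Pi.single j (-a * r₁ i)) ⬝ᵥ (c₁ + Pi.single i (a * c₁ j)) := by
    intro i j hij a r₁ c₁ h
    rw [h]
    -- The two first-order terms `± a * r₁ i * c₁ j` cancel, and the second-order term vanishes
    -- because `i ≠ j`.
    simp [hij]
    ring
  exact ⟨⟨invariant_of_orbit_eq hr h, invariant_of_orbit_eq hr h.symm⟩,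
    ⟨invariant_of_orbit_eq hc h, invariant_of_orbit_eq hc h.symm⟩,
    invariant_of_orbit_eq hd h rfl⟩

end Invariants

/-! ### Gaussian elimination of a single vector by transvections. -/

section Elimination

variable {ι K : Type*} [DecidableEq ι] [Field K]

/-- Adding `-c k / c t` times the pivot entry clears entry `k`. The pivot itself never changes, so
its value remains in the normal form. -/
theorem elimination_of_pivot {P : (ι → K) → Prop} {t : ι} (S : Finset ι) (ht : t ∉ S)
    (hP : ∀ i ∈ S, ∀ (a : K) (c : ι → K), P (c + Pi.single i (a * c t)) → P c)
    {c : ι → K} (hc : c t ≠ 0) (hS : ∀ i, i ≠ t → i ∉ S → c i = 0)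
    (h : P (Pi.single t (c t))) : P c := by
  induction S using Finset.induction_on generalizing c with
  | empty =>
    convert h
    ext i
    by_cases hi : i = t
    · subst hi; simp
    · simp [hi, hS i hi]
  | insert k S hk ih =>
    have hkt : t ≠ k := fun e => ht (by simp [e])
    apply hP k (by simp) (-c k / c t) c
    have hct : (c + Pi.single k (-c k / c t * c t) : ι → K) t = c t := by simp [hkt]
    apply ih (fun h => ht (by simp [h])) (fun i hi => hP i (by simp [hi]))
    · rwa [hct]
    · intro i hit hiS
      by_cases hik : i = k
      · subst hik; simp [hc]
      · simp [hik, hS i hit (by simp [hik, hiS])]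
    · rwa [hct]

/-- A nonzero entry at some `k ≠ t` can be used to turn entry `t` into `1`, which then serves as
pivot. The second index `k₀` is needed when `t` carries the only nonzero entry: transvections cannot
rescale in dimension one. -/
theorem elimination {P : (ι → K) → Prop} (S : Finset ι) {t k₀ : ι} (ht : t ∈ S) (hk₀ : k₀ ∈ S)
    (htk : k₀ ≠ t)
    (hP : ∀ i ∈ S, ∀ j, i ≠ j → ∀ (a : K) (c : ι → K), P (c + Pi.single i (a * c j)) → P c)
    {c : ι → K} (hc : c ≠ 0) (hS : ∀ i ∉ S, c i = 0) (h : P (Pi.single t 1)) : P c := by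
  have key : ∀ (c : ι → K) (k : ι), k ≠ t → c k ≠ 0 → (∀ i ∉ S, c i = 0) → P c := by
    intro c k hkt hk hS
    apply hP t ht k hkt.symm ((1 - c t) / c k) c
    have h1 : (c + Pi.single t ((1 - c t) / c k * c k) : ι → K) t = 1 := by simp [hk]
    refine elimination_of_pivot (S.erase t) (by simp)
      (fun i hi a c => hP i (Finset.mem_of_mem_erase hi) t (Finset.ne_of_mem_erase hi) a c)
      (by rw [h1]; exact one_ne_zero) ?_ (by rwa [h1])
    intro i hit hi
    simp [hit, hS i fun h => hi (Finset.mem_erase.2 ⟨hit, h⟩)]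
  obtain ⟨k, hk⟩ := Function.ne_iff.1 hc
  by_cases hkt : k = t
  · subst hkt
    by_cases h0 : c k₀ = 0
    · apply hP k₀ hk₀ k htk 1 c
      refine key _ k₀ htk (by simpa [h0] using hk) fun i hi => ?_
      have : i ≠ k₀ := fun e => hi (e ▸ hk₀)
      simp [this, hS i hi]
    · exact key c k₀ htk h0 hS
  · exact key c k hkt hk hS

end Elimination

/-! ### Reduction to the representatives. -/

section Reduction

variable {m : ℕ} {K : Type*} [Field K]

/-- A predicate that holds on the representatives and is reflected by `G_0` holds on all of `V_1`,
for `l = m + 3`. -/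
theorem coords_induction [NeZero (m + 1 + 2)] {P : V1 (m + 1 + 2) K → Prop}
    (hP : ∀ (g : G0 (m + 1 + 2) K) (v), P (g • v) → P v)
    (hI : P 0) (hIIa : P (ofCoords (m + 1) K (Pi.single 0 1, 0)))
    (hIIb : P (ofCoords (m + 1) K (0, Pi.single (Fin.last _) 1)))
    (hIII : ∀ c : Fin (m + 2) → K, c ≠ 0 → c 0 = 0 →
      P (ofCoords (m + 1) K (Pi.single 0 1, c)))
    (hVI : ∀ c : K, c ≠ 0 → P (ofCoords (m + 1) K (Pi.single 0 1, Pi.single 0 c)))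
    (v : V1 (m + 1 + 2) K) : P v := by
  obtain ⟨⟨r, c⟩, rfl⟩ := ofCoords_surjective v
  have step : ∀ (i j : Fin (m + 2)) (h : i ≠ j) (a : K) (r c : Fin (m + 2) → K),
      P (ofCoords (m + 1) K (r + Pi.single j (-a * r i), c + Pi.single i (a * c j))) →
      P (ofCoords (m + 1) K (r, c)) := by
    intro i j h a r c hrc
    apply hP (x0 h a)
    rwa [x0_smul_ofCoords]
  have h0l : (0 : Fin (m + 2)) ≠ Fin.last _ := Fin.last_pos.ne
  by_cases hr : r = 0
  · subst hr
    by_cases hc : c = 0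
    · subst hc
      rw [Prod.mk_zero_zero, map_zero]
      exact hI
    · refine elimination (P := fun c => P (ofCoords (m + 1) K (0, c))) Finset.univ
        (Finset.mem_univ (Fin.last _)) (Finset.mem_univ 0) h0l ?_ hc (by simp) hIIb
      intro i _ j hij a c h
      apply step i j hij a
      simpa using h
  -- Moving `r` also changes `c`, so the elimination runs with `c` universally quantified.
  · suffices h : ∀ c, P (ofCoords (m + 1) K (r, c)) from h c
    refine elimination (P := fun r => ∀ c, P (ofCoords (m + 1) K (r, c))) Finset.univ
      (Finset.mem_univ 0) (Finset.mem_univ (Fin.last _)) h0l.symm ?_ hr (by simp) ?_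
    · intro j _ i hij a r h c
      -- The action on the row is contragredient: indices swap roles and the sign flips.
      apply step i j hij.symm (-a)
      rw [neg_neg]
      exact h _
    · intro c
      by_cases hc : c = 0
      · rw [hc]
        exact hIIa
      by_cases hc0 : c 0 = 0
      · exact hIII c hc hc0
      · refine elimination_of_pivot
          (P := fun c => P (ofCoords (m + 1) K (Pi.single 0 1, c))) (t := 0)
          (Finset.univ.erase 0) (by simp) ?_ hc0 (by simp +contextual) (hVI _ hc0)
        intro i hi a c h
        -- For `i ≠ 0` the row has `r i = 0`, so the transvection leaves it unchanged.
        have hi0 : i ≠ 0 := Finset.ne_of_mem_erase hi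
        apply step i 0 hi0 a
        simpa [hi0] using h

/-- For `l ≥ 4` the group `G_0` has only one orbit of pairs of non-zero orthogonal vectors. -/
theorem coords_induction_orthogonal [NeZero (m + 1 + 1 + 2)] {P : V1 (m + 1 + 1 + 2) K → Prop}
    (hP : ∀ (g : G0 (m + 1 + 1 + 2) K) (v), P (g • v) → P v)
    (h : P (ofCoords (m + 2) K (Pi.single 0 1, Pi.single (Fin.last _) 1)))
    {c : Fin (m + 3) → K} (hc : c ≠ 0) (hc0 : c 0 = 0) :
    P (ofCoords (m + 2) K (Pi.single 0 1, c)) := by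
  have h1l : (1 : Fin (m + 3)) ≠ Fin.last _ := by
    intro h
    have := congrArg Fin.val h
    simp at this
  -- Only the entries at nonzero indices may change, so that the row stays fixed; `1` and the last
  -- index are distinct among them because `l ≥ 4`.
  refine elimination (P := fun c => P (ofCoords (m + 2) K (Pi.single 0 1, c)))
    (Finset.univ.erase 0) (t := Fin.last _) (k₀ := 1) (by simp [Fin.last_pos.ne'])
    (by simp) h1l ?_ hc (by simp [hc0]) h
  intro i hi j hij a c h
  have hi0 : i ≠ 0 := Finset.ne_of_mem_erase hi
  apply hP (x0 hij a)
  rw [x0_smul_ofCoords]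
  simpa [hi0] using h

end Reduction

/-! ### Coordinates of the representatives. -/

section Representatives

variable {n : ℕ} [NeZero (n + 2)] {K : Type*} [Field K]

theorem eRho_eq (hl : 2 ≤ n + 2) : eRho (n + 2) K hl = ofCoords n K (Pi.single 0 1, 0) := by
  rw [ofCoords_single_left]
  rfl

theorem eSigma_eq (hl : 2 ≤ n + 2) :
    eSigma (n + 2) K hl = ofCoords n K (0, Pi.single (Fin.last _) 1) := by
  rw [ofCoords_single_right]
  rfl

theorem eDeltaSubRho_eq (hl : 2 ≤ n + 2) :
    eDeltaSubRho (n + 2) K hl = ofCoords n K (0, Pi.single 0 1) := by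
  rw [ofCoords_single_right]
  rfl

theorem ofCoords_add_smul (r c : Fin (n + 1) → K) (a : K) :
    ofCoords n K (r, 0) + a • ofCoords n K (0, c) = ofCoords n K (r, a • c) := by
  rw [← map_smul, ← map_add]
  simp

/-- The coordinates of the representatives for `l = 3`. -/
def Types3.coords : Types3 K → (Fin 2 → K) × (Fin 2 → K)
  | .I => 0
  | .IIa => (Pi.single 0 1, 0)
  | .IIb => (0, Pi.single 1 1)
  | .III c => (Pi.single 0 1, Pi.single 1 (c : K))
  | .VI c => (Pi.single 0 1, Pi.single 0 (c : K))

theorem Types3.vector_eq [NeZero (1 + 2)] (hl : 1 + 2 = 3) (t : Types3 K) :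
    t.vector (1 + 2) hl = ofCoords 1 K t.coords := by
  cases t with
  | I => exact (map_zero _).symm
  | IIa => exact eRho_eq (by omega)
  | IIb => exact eSigma_eq (by omega)
  | III c =>
    rw [Types3.vector, eRho_eq, eSigma_eq, ofCoords_add_smul, ← Pi.single_smul, smul_eq_mul,
      mul_one]
    rfl
  | VI c =>
    rw [Types3.vector, eRho_eq, eDeltaSubRho_eq, ofCoords_add_smul, ← Pi.single_smul,
      smul_eq_mul, mul_one]
    rfl

/-- The coordinates of the representatives for `l > 3`. -/
def TypesGT3.coords (n : ℕ) : TypesGT3 K → (Fin (n + 1) → K) × (Fin (n + 1) → K)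
  | .I => 0
  | .IIa => (Pi.single 0 1, 0)
  | .IIb => (0, Pi.single (Fin.last _) 1)
  | .III => (Pi.single 0 1, Pi.single (Fin.last _) 1)
  | .VI c => (Pi.single 0 1, Pi.single 0 (c : K))

theorem TypesGT3.vector_eq (hl : 3 < n + 2) (t : TypesGT3 K) :
    t.vector (n + 2) hl = ofCoords n K (t.coords n) := by
  cases t with
  | I => exact (map_zero _).symm
  | IIa => exact eRho_eq (by omega)
  | IIb => exact eSigma_eq (by omega)
  | III =>
    rw [TypesGT3.vector, eRho_eq, eSigma_eq, ← map_add, Prod.mk_add_mk, add_zero, zero_add]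
    rfl
  | VI c =>
    rw [TypesGT3.vector, eRho_eq, eDeltaSubRho_eq, ofCoords_add_smul, ← Pi.single_smul,
      smul_eq_mul, mul_one]
    rfl

end Representatives

/-! ### The orbits for each rank. -/

section Orbits

variable {K : Type*} [Field K]

theorem V1_one_eq_zero [NeZero 1] (v : V1 1 K) : v = 0 := by
  have h : Phi 1 1 = ∅ := by
    ext ⟨⟨p, q⟩, hpq⟩
    rw [mem_Phi_one_iff]
    fin_cases p <;> fin_cases q <;> first | exact absurd rfl hpq | simp
  have hV : V1 1 K = ⊥ := by rw [V1, h, Set.image_empty, Submodule.span_empty]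
  exact Subtype.ext ((Submodule.mem_bot K).1 (hV ▸ v.2))

instance : Subsingleton (Fin (0 + 1)) := inferInstanceAs (Subsingleton (Fin 1))

theorem existsUnique_coords_two [NeZero (0 + 2)] (hl : 2 ≤ 0 + 2) (v : V1 (0 + 2) K) :
    ∃! p : K × K, v = p.1 • eRho (0 + 2) K hl + p.2 • eDeltaSubRho (0 + 2) K hl := by
  have h : ∀ a b : K, a • eRho (0 + 2) K hl + b • eDeltaSubRho (0 + 2) K hl =
      ofCoords 0 K (Pi.single 0 a, Pi.single 0 b) := by
    intro a b
    rw [eRho_eq, eDeltaSubRho_eq, ← map_smul, ← map_smul, ← map_add]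
    simp [← Pi.single_smul]
  simp only [h]
  obtain ⟨⟨r, c⟩, rfl⟩ := ofCoords_surjective v
  refine ⟨(r 0, c 0), ?_, ?_⟩
  · congr 2 <;> ext i <;> simp [Subsingleton.elim i 0]
  · rintro ⟨a, b⟩ hab
    have hab := Prod.mk.inj (ofCoords_injective hab)
    simp [hab.1, hab.2]

/-- With a single middle index there is no pair `i ≠ j`, hence no generator to check. -/
theorem orbit_two [NeZero (0 + 2)] (v : V1 (0 + 2) K) :
    MulAction.orbit (G0 (0 + 2) K) v = {v} := by
  refine Set.Subset.antisymm ?_ (by simp)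
  rintro _ ⟨g, rfl⟩
  exact invariant_smul (P := fun w => w = v)
    (fun i j h => absurd (Subsingleton.elim i j) h) g rfl

theorem exists_types3 [NeZero (1 + 2)] (hl : 1 + 2 = 3) (v : V1 (1 + 2) K) :
    ∃ t : Types3 K, v ∈ MulAction.orbit (G0 (1 + 2) K) (t.vector (1 + 2) hl) := by
  simp only [Types3.vector_eq]
  refine coords_induction (m := 0) (P := fun v => ∃ t : Types3 K,
    v ∈ MulAction.orbit (G0 (1 + 2) K) (ofCoords 1 K t.coords)) ?_ ?_ ?_ ?_ ?_ ?_ v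
  · rintro g v ⟨t, ht⟩
    exact ⟨t, mem_orbit_of_smul_mem ht⟩
  · exact ⟨.I, by simp [Types3.coords]⟩
  · exact ⟨.IIa, MulAction.mem_orbit_self _⟩
  · exact ⟨.IIb, MulAction.mem_orbit_self _⟩
  · intro c hc hc0
    have hc1 : c = Pi.single 1 (c 1) := by
      ext i
      fin_cases i <;> simp [hc0]
    have h1 : c 1 ≠ 0 := fun h => hc (by rw [hc1, h, Pi.single_zero])
    refine ⟨.III (Units.mk0 (c 1) h1), ?_⟩
    change ofCoords 1 K (Pi.single 0 1, c) ∈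
      MulAction.orbit _ (ofCoords 1 K (Pi.single 0 1, Pi.single 1 (c 1)))
    rw [← hc1]
    exact MulAction.mem_orbit_self _
  · exact fun c hc => ⟨.VI (Units.mk0 c hc), MulAction.mem_orbit_self _⟩

theorem orbit_types3_ne [NeZero (1 + 2)] (hl : 1 + 2 = 3) {s t : Types3 K} (hst : s ≠ t) :
    MulAction.orbit (G0 (1 + 2) K) (s.vector (1 + 2) hl) ≠
      MulAction.orbit (G0 (1 + 2) K) (t.vector (1 + 2) hl) := by
  rw [Types3.vector_eq, Types3.vector_eq]
  intro h
  have hinv := orbit_invariants h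
  cases s <;> cases t <;> simp at hinv hst
  case III.III c d =>
    -- The three general invariants agree on type `III`. The finer one is the factor between the
    -- column and `(-r 1, r 0)`, which spans the vectors orthogonal to a nonzero row and transforms
    -- under `SL_2` like a column.
    have := invariant_of_orbit_eq (n := 1)
      (P := fun r v => v 0 = -(c : K) * r 1 ∧ v 1 = (c : K) * r 0) ?_ h
      (by simp)
    · simp at this
      exact hst (Units.ext this.symm)
    · rintro i j hij a r v ⟨h0, h1⟩
      fin_cases i <;> fin_cases j <;> simp [h0, h1] at hij ⊢ <;> ring
  case III.VI _ c => exact c.ne_zero hinv.symm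
  case VI.VI c d => exact hst (Units.ext hinv)

theorem exists_typesGT3 {m : ℕ} [NeZero (m + 1 + 1 + 2)] (hl : 3 < m + 1 + 1 + 2)
    (v : V1 (m + 1 + 1 + 2) K) : ∃ t : TypesGT3 K,
      v ∈ MulAction.orbit (G0 (m + 1 + 1 + 2) K) (t.vector (m + 1 + 1 + 2) hl) := by
  simp only [TypesGT3.vector_eq]
  have hP : ∀ (g : G0 (m + 1 + 1 + 2) K) (v), (∃ t : TypesGT3 K,
      g • v ∈ MulAction.orbit (G0 (m + 1 + 1 + 2) K) (ofCoords (m + 1 + 1) K (t.coords _))) →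
      ∃ t : TypesGT3 K,
        v ∈ MulAction.orbit (G0 (m + 1 + 1 + 2) K) (ofCoords (m + 1 + 1) K (t.coords _)) := by
    rintro g v ⟨t, ht⟩
    exact ⟨t, mem_orbit_of_smul_mem ht⟩
  refine coords_induction (P := fun v => ∃ t : TypesGT3 K,
    v ∈ MulAction.orbit (G0 (m + 1 + 1 + 2) K) (ofCoords (m + 1 + 1) K (t.coords _)))
    hP ?_ ?_ ?_ ?_ ?_ v
  · exact ⟨.I, by simp [TypesGT3.coords]⟩
  · exact ⟨.IIa, MulAction.mem_orbit_self _⟩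
  · exact ⟨.IIb, MulAction.mem_orbit_self _⟩
  · intro c hc hc0
    exact coords_induction_orthogonal (P := fun v => ∃ t : TypesGT3 K,
      v ∈ MulAction.orbit (G0 (m + 1 + 1 + 2) K) (ofCoords (m + 1 + 1) K (t.coords _)))
      hP ⟨.III, MulAction.mem_orbit_self _⟩ hc hc0
  · exact fun c hc => ⟨.VI (Units.mk0 c hc), MulAction.mem_orbit_self _⟩

theorem orbit_typesGT3_ne {n : ℕ} [NeZero (n + 2)] (hl : 3 < n + 2) {s t : TypesGT3 K}
    (hst : s ≠ t) : MulAction.orbit (G0 (n + 2) K) (s.vector (n + 2) hl) ≠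
      MulAction.orbit (G0 (n + 2) K) (t.vector (n + 2) hl) := by
  rw [TypesGT3.vector_eq, TypesGT3.vector_eq]
  intro h
  have hinv := orbit_invariants h
  have h0l : (0 : Fin (n + 1)) ≠ Fin.last n := by
    intro h
    have := congrArg Fin.val h
    simp at this
    omega
  cases s <;> cases t <;> simp [h0l] at hinv hst
  case III.VI c => exact c.ne_zero hinv.symm
  case VI.VI c d => exact hst (Units.ext hinv)

end Orbits

end TypeA

/-- Orbits of `G_0` on `V_1` for `Φ = A_l`, over an arbitrary field `K`. In each of the cases
`l = 3` and `l > 3`, every vector lies in the orbit of a listed one, and listed vectors with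
different labels lie in different orbits. -/
theorem mainTheorem4 {K : Type*} [Field K] (l : ℕ) [NeZero l] :
    (l = 1 → ∀ x : TypeA.V1 l K, x = 0) ∧
    (∀ hl : l = 2,
      (∀ x : TypeA.V1 l K, ∃! p : K × K,
        x = p.1 • TypeA.eRho l K (by omega) + p.2 • TypeA.eDeltaSubRho l K (by omega)) ∧
      (∀ x : TypeA.V1 l K, MulAction.orbit (TypeA.G0 l K) x = {x})) ∧
    (∀ hl : l = 3,
      (∀ x : TypeA.V1 l K, ∃ t : TypeA.Types3 K,
        x ∈ MulAction.orbit (TypeA.G0 l K) (t.vector l hl)) ∧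
      (∀ s t : TypeA.Types3 K, s ≠ t →
        MulAction.orbit (TypeA.G0 l K) (s.vector l hl) ≠
          MulAction.orbit (TypeA.G0 l K) (t.vector l hl))) ∧
    (∀ hl : 3 < l,
      (∀ x : TypeA.V1 l K, ∃ t : TypeA.TypesGT3 K,
        x ∈ MulAction.orbit (TypeA.G0 l K) (t.vector l hl)) ∧
      (∀ s t : TypeA.TypesGT3 K, s ≠ t →
        MulAction.orbit (TypeA.G0 l K) (s.vector l hl) ≠
          MulAction.orbit (TypeA.G0 l K) (t.vector l hl))) := by
  refine ⟨?_, ?_, ?_, ?_⟩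
  · rintro rfl
    exact TypeA.V1_one_eq_zero
  · rintro rfl
    exact ⟨TypeA.existsUnique_coords_two _, TypeA.orbit_two⟩
  · rintro rfl
    exact ⟨TypeA.exists_types3 rfl, fun _ _ => TypeA.orbit_types3_ne rfl⟩
  · intro hl
    -- There are `l - 1 = m + 3` middle indices: one for the row and at least two more for the
    -- column.
    obtain ⟨m, rfl⟩ : ∃ m, l = m + 1 + 1 + 2 := ⟨l - 4, by omega⟩
    exact ⟨TypeA.exists_typesGT3 hl, fun _ _ => TypeA.orbit_typesGT3_ne hl⟩
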